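/- Let $\mathcal I=\{1,\dots,n\}$ and, for $i\in\mathcal I$, let $(X_i,d)$ be a nonempty complete metric space and $\varphi_i:X_i\to X_i$ a map with $$L_i=\sup_{x\ne y\in X_i}\frac{d(\varphi_i(x),\varphi_i(y))}{d(x,y)}<\infty .$$ Let $X=\prod_{i\in\mathcal I}X_i$ carry the metric $d_{\max}(\mathbf x,\mathbf y)=\max_i d(x_i,y_i)$ and put $\varphi(\mathbf x)=(\varphi_i(x_i))_{i\in\mathcal I}$. For each $j\in\mathcal I$ let $\mathcal I_j\subseteq\mathcal I$ be nonempty and $F_j:\prod_{i\in\mathcal I_j}X_i\to X_j$ continuous; let $F:X\to X$, $F(\mathbf x)_j=F_j(\mathbf x|_{\mathcal I_j})$. The map $\mathcal F=F\circ\varphi$ defines the dynamical network $(\mathcal F,X)$. Its components $\mathcal F_j$ are functions of the variables $x_i$, $i\in\mathcal I_j$. A *stability matrix* of $(\mathcal F,X)$ is a matrix $\Lambda^T\cdot\mathrm{diag}[L_1,\dots,L_n]$, where $\Lambda\in\mathbb R^{n\times n}$ satisfies $\Lambda_{ij}\ge 0$, $\Lambda_{ij}=0$ for $i\notin\mathcal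 I_j$, and $$d\big(F_j(\mathbf x|_{\mathcal I_j}),F_j(\mathbf y|_{\mathcal I_j})\big)\le\sum_{i\in\mathcal I_j}\Lambda_{ij}\,d(x_i,y_i)\qquad\text{for all } j\in\mathcal I,\ \mathbf x,\mathbf y\in X .$$ The *graph of interactions* $\Gamma_{\mathcal F}$ is the directed graph with vertices $v_1,\dots,v_n$ and an edge from $v_i$ to $v_j$ exactly when $i\in\mathcal I_j$. A set $S$ of vertices is a *complete structural set* if each cycle of $\Gamma_{\mathcal F}$ (loops are cycles) contains a vertex of $S$, and each vertex belongs to a path or cycle that begins and ends with a vertex of $S$. Let $\mathcal I_S$ be the set of indices of the vertices in $S$. For a complete structural set $S$ and $j\in\mathcal I_S$ let $\mathcal F_{(j,0)}=\mathcal F_j$, and for $k\ge1$ let $\mathcal F_{(j,k)}$ be the function $\mathcal F_{(j,k-1)}$ in which each variable $x_\ell$ with $\ell\notin\mathcal I_S$ is replaced by the function $\mathcal F_\ell$. After finitely many steps all variables are indexed by $\mathcal I_S$; the first such function is denoted $\mathcal R_S\mathcal F_j$. The *restriction* of $(\mathcal F,X)$ to $S$ is the dynamical network $(\mathcal R_S\mathcal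 F,X|_S)$ without local dynamics, where $X|_S=\prod_{i\in\mathcal I_S}X_i$ and $\mathcal R_S\mathcal F=(\mathcal R_S\mathcal F_j)_{j\in\mathcal I_S}$. **Theorem.** Suppose $A$ is a stability matrix of $(\mathcal F,X)$ with spectral radius $\rho(A)<1$. Then for every complete structural set $S$ of $\Gamma_{\mathcal F}$ the restriction $(\mathcal R_S\mathcal F,X|_S)$ has a globally attracting fixed point: there is $\tilde{\mathbf x}\in X|_S$ with $\mathcal R_S\mathcal F(\tilde{\mathbf x})=\tilde{\mathbf x}$ and $\lim_{k\to\infty}d_{\max}\big((\mathcal R_S\mathcal F)^k(\mathbf x),\tilde{\mathbf x}\big)=0$ for every $\mathbf x\in X|_S$. -/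

import Mathlib

open Filter Topology

/-- A dynamical network on the product of the metric spaces `X i`: local maps `φ i` with finite
Lipschitz constant, and an interaction whose `j`-th component is a continuous function of the
coordinates in the nonempty index set `I j`. -/
structure DynamicalNetwork {ι : Type*} (X : ι → Type*) [∀ i, MetricSpace (X i)] where
  /-- the local systems -/
  φ : ∀ i, X i → X i
  /-- the difference quotients of each local system are bounded, that is, `L i < ∞` -/
  bddAbove_φ : ∀ i,
    BddAbove {r : ℝ | ∃ x y : X i, x ≠ y ∧ r = dist (φ i x) (φ i y) / dist x y}
  /-- the index set of the variables of the `j`-th component of the interaction -/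
  I : ι → Finset ι
  I_nonempty : ∀ j, (I j).Nonempty
  /-- the components of the interaction -/
  F : ∀ j, (∀ i : I j, X i) → X j
  continuous_F : ∀ j, Continuous (F j)

/-- A continuous `X j`-valued function of the variables `x i`, `i ∈ vars`, together with its
nonempty set of variables. -/
structure NetworkComponent {ι : Type*} (X : ι → Type*) [∀ i, MetricSpace (X i)] (j : ι) where
  vars : Finset ι
  vars_nonempty : vars.Nonempty
  toFun : (∀ i : vars, X i) → X j
  continuous_toFun : Continuous toFun

/-- A path in a directed graph: a nonempty sequence of distinct vertices, with an edge from each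
one to the next. -/
def Digraph.IsPathList {V : Type*} (G : Digraph V) (p : List V) : Prop :=
  p ≠ [] ∧ p.Nodup ∧ p.IsChain G.Adj

/-- The list `v₁, …, vₘ` stands for the cycle `v₁ → … → vₘ → v₁`: the listed vertices are
distinct, and there is also an edge from the last one back to the first. A loop is a cycle
with `m = 1`. -/
def Digraph.IsCycleList {V : Type*} (G : Digraph V) (c : List V) : Prop :=
  G.IsPathList c ∧ ∀ a ∈ c.getLast?, ∀ b ∈ c.head?, G.Adj a b

/-- A complete structural set of a directed graph: it meets every cycle, and each vertex belongs
to a path or a cycle that begins and ends with a vertex of `S`. -/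
def Digraph.IsCompleteStructuralSet {V : Type*} (G : Digraph V) (S : Finset V) : Prop :=
  (∀ c, G.IsCycleList c → ∃ v ∈ c, v ∈ S) ∧
  ∀ v : V,
    (∃ p, G.IsPathList p ∧ v ∈ p ∧ (∀ a ∈ p.head?, a ∈ S) ∧ ∀ b ∈ p.getLast?, b ∈ S) ∨
    (∃ c, G.IsCycleList c ∧ v ∈ c ∧ ∀ a ∈ c.head?, a ∈ S)

/-- A walk that avoids a complete structural set repeats no vertex. -/
theorem Digraph.IsCompleteStructuralSet.nodup {V : Type*} {G : Digraph V} {S : Finset V}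
    (hS : G.IsCompleteStructuralSet S) (l : List V) (hl : l.IsChain G.Adj)
    (h : ∀ v ∈ l, v ∉ S) : l.Nodup := by
  induction l with
  | nil => exact List.nodup_nil
  | cons a l ih =>
    have hnd : l.Nodup := ih hl.tail (fun v hv => h v (List.mem_cons_of_mem _ hv))
    refine List.nodup_cons.2 ⟨fun ha => ?_, hnd⟩
    obtain ⟨s, t, rfl⟩ := List.append_of_mem ha
    have has : a ∉ s := fun hs =>
      (List.nodup_append.1 hnd).2.2 a hs a (List.mem_cons_self) rfl
    have hsnd : (a :: s).Nodup :=
      List.nodup_cons.2 ⟨has, (List.nodup_append.1 hnd).1⟩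
    rw [← List.cons_append, List.isChain_append] at hl
    obtain ⟨v, hv, hvS⟩ := hS.1 (a :: s) ⟨⟨List.cons_ne_nil _ _, hsnd, hl.1⟩, by
      intro x hx b hb
      have : b = a := by simpa using hb.symm
      subst this
      exact hl.2.2 x hx b (by simp)⟩
    refine h v ?_ hvS
    rw [← List.cons_append]
    exact List.mem_append_left _ hv

namespace DynamicalNetwork

/-- The Lipschitz constant of the `i`-th local system, the supremum of its difference
quotients (it is `0` if the space is a single point). -/
noncomputable def L {ι : Type*} {X : ι → Type*} [∀ i, MetricSpace (X i)]
    (N : DynamicalNetwork X) (i : ι) : ℝ :=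
  sSup {r : ℝ | ∃ x y : X i, x ≠ y ∧ r = dist (N.φ i x) (N.φ i y) / dist x y}

theorem dist_φ_le {ι : Type*} {X : ι → Type*} [∀ i, MetricSpace (X i)]
    (N : DynamicalNetwork X) (i : ι) (x y : X i) :
    dist (N.φ i x) (N.φ i y) ≤ N.L i * dist x y := by
  rcases eq_or_ne x y with rfl | hxy
  · simp
  · rw [← div_le_iff₀ (dist_pos.2 hxy)]
    exact le_csSup (N.bddAbove_φ i) ⟨x, y, hxy, rfl⟩

theorem continuous_φ {ι : Type*} {X : ι → Type*} [∀ i, MetricSpace (X i)]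
    (N : DynamicalNetwork X) (i : ι) : Continuous (N.φ i) :=
  (LipschitzWith.of_dist_le' (N.dist_φ_le i)).continuous

/-- The interaction `F : X → X`. -/
def interaction {ι : Type*} {X : ι → Type*} [∀ i, MetricSpace (X i)]
    (N : DynamicalNetwork X) (x : ∀ i, X i) : ∀ i, X i :=
  fun j => N.F j (fun i => x i)

/-- The map `𝓕 = F ∘ φ` of the network. -/
def map {ι : Type*} {X : ι → Type*} [∀ i, MetricSpace (X i)]
    (N : DynamicalNetwork X) (x : ∀ i, X i) : ∀ i, X i :=
  N.interaction (fun i => N.φ i (x i))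

/-- The `j`-th component `𝓕ⱼ` of `𝓕 = F ∘ φ`, as a function of the variables in `I j`. -/
def component {ι : Type*} {X : ι → Type*} [∀ i, MetricSpace (X i)]
    (N : DynamicalNetwork X) (j : ι) : NetworkComponent X j where
  vars := N.I j
  vars_nonempty := N.I_nonempty j
  toFun y := N.F j (fun i => N.φ i (y i))
  continuous_toFun := (N.continuous_F j).comp
    (continuous_pi fun i => (N.continuous_φ i).comp (continuous_apply i))

/-- The constants `Λ i j` are nonnegative, vanish for `i ∉ I j`, and are Lipschitz constants of
the interaction. -/
def IsLipschitzMatrix {ι : Type*} {X : ι → Type*} [∀ i, MetricSpace (X i)]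
    (N : DynamicalNetwork X) (Λ : Matrix ι ι ℝ) : Prop :=
  (∀ i j, 0 ≤ Λ i j) ∧ (∀ i j, i ∉ N.I j → Λ i j = 0) ∧
  ∀ (j : ι) (x y : ∀ i, X i),
    dist (N.F j (fun i => x i)) (N.F j (fun i => y i)) ≤
      ∑ i ∈ N.I j, Λ i j * dist (x i) (y i)

open scoped Matrix in
/-- A stability matrix of the network: `Λᵀ · diag(L)`. -/
def IsStabilityMatrix {ι : Type*} [Fintype ι] [DecidableEq ι] {X : ι → Type*}
    [∀ i, MetricSpace (X i)] (N : DynamicalNetwork X) (A : Matrix ι ι ℝ) : Prop :=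
  ∃ Λ : Matrix ι ι ℝ, N.IsLipschitzMatrix Λ ∧ A = Λᵀ * Matrix.diagonal N.L

/-- There is a fixed point that attracts all orbits. The distance is the maximum distance on
the product. -/
def HasGloballyAttractingFixedPoint {ι : Type*} [Fintype ι] {X : ι → Type*}
    [∀ i, MetricSpace (X i)] (N : DynamicalNetwork X) : Prop :=
  ∃ p : ∀ i, X i, N.map p = p ∧
    ∀ x : ∀ i, X i, Tendsto (fun k : ℕ => dist (N.map^[k] x) p) atTop (𝓝 0)

/-- The graph of interactions: an edge from `i` to `j` whenever `i ∈ I j`. -/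
def graph {ι : Type*} {X : ι → Type*} [∀ i, MetricSpace (X i)]
    (N : DynamicalNetwork X) : Digraph ι where
  Adj i j := i ∈ N.I j

/-- The variables that the variable `x l` leaves behind when it is replaced by `𝓕ₗ` in the case
`l ∉ S` and kept in the case `l ∈ S`. -/
def substVars {ι : Type*} [DecidableEq ι] {X : ι → Type*} [∀ i, MetricSpace (X i)]
    (N : DynamicalNetwork X) (S : Finset ι) (l : ι) : Finset ι :=
  if l ∈ S then {l} else N.I l

/-- Replace, in a function of finitely many coordinates, each variable `x l` with `l ∉ S` by the
function `𝓕ₗ`. -/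
def substitute {ι : Type*} [DecidableEq ι] {X : ι → Type*} [∀ i, MetricSpace (X i)]
    (N : DynamicalNetwork X) (S : Finset ι) {j : ι} (f : NetworkComponent X j) :
    NetworkComponent X j where
  vars := f.vars.biUnion (N.substVars S)
  vars_nonempty := by
    obtain ⟨l, hl⟩ := f.vars_nonempty
    by_cases h : l ∈ S
    · exact ⟨l, Finset.mem_biUnion.2 ⟨l, hl, by simp [substVars, h]⟩⟩
    · obtain ⟨i, hi⟩ := N.I_nonempty l
      exact ⟨i, Finset.mem_biUnion.2 ⟨l, hl, by simpa [substVars, h] using hi⟩⟩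
  toFun y := f.toFun fun l =>
    if h : (l : ι) ∈ S then
      y ⟨l, Finset.mem_biUnion.2 ⟨l, l.2, by simp [substVars, h]⟩⟩
    else
      (N.component l).toFun fun i =>
        y ⟨i, Finset.mem_biUnion.2 ⟨l, l.2, by
          rw [substVars, if_neg h]; exact i.2⟩⟩
  continuous_toFun := by
    refine f.continuous_toFun.comp (continuous_pi fun l => ?_)
    by_cases h : (l : ι) ∈ S
    · simp only [h, dif_pos]
      exact continuous_apply _
    · simp only [h, dif_neg, not_false_eq_true]
      exact (N.component l).continuous_toFun.comp (continuous_pi fun i => continuous_apply _)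

/-- The function that arises from `𝓕ⱼ` after `k` rounds of substitution. -/
def iterSubstitute {ι : Type*} [DecidableEq ι] {X : ι → Type*} [∀ i, MetricSpace (X i)]
    (N : DynamicalNetwork X) (S : Finset ι) (j : ι) : ℕ → NetworkComponent X j
  | 0 => N.component j
  | k + 1 => N.substitute S (N.iterSubstitute S j k)

/-- A variable outside `S` that is present after `k` rounds starts a walk with `k + 1` vertices
outside `S`. -/
theorem exists_walk_of_mem_vars {ι : Type*} [DecidableEq ι] {X : ι → Type*}
    [∀ i, MetricSpace (X i)] (N : DynamicalNetwork X) (S : Finset ι) (j : ι) (k : ℕ) (v : ι)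
    (hv : v ∈ (N.iterSubstitute S j k).vars) (hvS : v ∉ S) :
    ∃ l : List ι, l.length = k ∧ (v :: l).IsChain N.graph.Adj ∧ ∀ w ∈ v :: l, w ∉ S := by
  induction k generalizing v with
  | zero => exact ⟨[], rfl, by simp, by simpa using hvS⟩
  | succ k ih =>
    obtain ⟨u, hu, huv⟩ := Finset.mem_biUnion.1 hv
    by_cases h : u ∈ S
    · rw [substVars, if_pos h, Finset.mem_singleton] at huv
      exact absurd (huv ▸ h) hvS
    · rw [substVars, if_neg h] at huv
      obtain ⟨l, hl, hc, hw⟩ := ih u hu h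
      refine ⟨u :: l, by simp [hl], List.isChain_cons_cons.2 ⟨huv, hc⟩, ?_⟩
      intro w hw'
      rcases List.mem_cons.1 hw' with rfl | hw'
      · exact hvS
      · exact hw w hw'

/-- The substitution procedure ends: after finitely many rounds all variables are in `S`. -/
theorem exists_vars_subset {ι : Type*} [Fintype ι] [DecidableEq ι] {X : ι → Type*}
    [∀ i, MetricSpace (X i)] (N : DynamicalNetwork X) (S : Finset ι)
    (hS : N.graph.IsCompleteStructuralSet S) (j : ι) :
    ∃ k, (N.iterSubstitute S j k).vars ⊆ S := by
  refine ⟨Fintype.card ι, fun v hv => ?_⟩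
  by_contra hvS
  obtain ⟨l, hl, hc, hw⟩ := N.exists_walk_of_mem_vars S j _ v hv hvS
  have := (hS.nodup _ hc hw).length_le_card
  simp [hl] at this

/-- The component `𝓡ₛ𝓕ⱼ` of the restriction: the first function in the substitution procedure
all of whose variables are in `S`. -/
def restrictedComponent {ι : Type*} [Fintype ι] [DecidableEq ι] {X : ι → Type*}
    [∀ i, MetricSpace (X i)] (N : DynamicalNetwork X) (S : Finset ι)
    (hS : N.graph.IsCompleteStructuralSet S) (j : ι) : NetworkComponent X j :=
  N.iterSubstitute S j (Nat.find (N.exists_vars_subset S hS j))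

theorem restrictedComponent_vars_subset {ι : Type*} [Fintype ι] [DecidableEq ι] {X : ι → Type*}
    [∀ i, MetricSpace (X i)] (N : DynamicalNetwork X) (S : Finset ι)
    (hS : N.graph.IsCompleteStructuralSet S) (j : ι) :
    (N.restrictedComponent S hS j).vars ⊆ S :=
  Nat.find_spec (N.exists_vars_subset S hS j)

/-- The restriction of the network to a complete structural set `S`: the network without local
dynamics on the product of the spaces `X i`, `i ∈ S`, with the components `𝓡ₛ𝓕ⱼ`, `j ∈ S`. -/
def restriction {ι : Type*} [Fintype ι] [DecidableEq ι] {X : ι → Type*}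
    [∀ i, MetricSpace (X i)] (N : DynamicalNetwork X) (S : Finset ι)
    (hS : N.graph.IsCompleteStructuralSet S) : DynamicalNetwork (fun i : S => X i) where
  φ _ := id
  bddAbove_φ i := by
    refine ⟨1, ?_⟩
    rintro r ⟨x, y, hxy, rfl⟩
    exact (div_self (dist_pos.2 hxy).ne').le
  I j := (N.restrictedComponent S hS j).vars.subtype (· ∈ S)
  I_nonempty j := by
    obtain ⟨i, hi⟩ := (N.restrictedComponent S hS j).vars_nonempty
    exact ⟨⟨i, N.restrictedComponent_vars_subset S hS j hi⟩, Finset.mem_subtype.2 hi⟩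
  F j y := (N.restrictedComponent S hS j).toFun fun i =>
    y ⟨⟨i, N.restrictedComponent_vars_subset S hS j i.2⟩, Finset.mem_subtype.2 i.2⟩
  continuous_F j := (N.restrictedComponent S hS j).continuous_toFun.comp
    (continuous_pi fun _ => continuous_apply _)

end DynamicalNetwork

/-! Since `A` is nonnegative with spectral radius below one, there are weights `w > 0` and `c < 1`
with `A w ≤ c w`. In the weighted maximum distance `max dist (x i) (y i) / w i`, every component of
the network then contracts by `c`. Replacing a variable by such a component keeps it within the
bound it had before, because `c ≤ 1`, so any number of substitutions preserves the contraction. The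
restriction to `S` therefore contracts the distance weighted by `w` on `S`, and the argument of
Banach's theorem applies. No comparison of spectral radii between the two networks is needed. -/

open scoped Matrix in
/-- A nonnegative matrix of spectral radius less than one contracts a positive weighted maximum
norm. -/
theorem Matrix.exists_pos_weight_of_spectralRadius_lt_one {ι : Type*} [Fintype ι] [DecidableEq ι]
    (A : Matrix ι ι ℝ) (hA : ∀ i j, 0 ≤ A i j)
    (hρ : spectralRadius ℂ (A.map (algebraMap ℝ ℂ)) < 1) :
    ∃ (w : ι → ℝ) (c : ℝ), (∀ i, 0 < w i) ∧ 0 ≤ c ∧ c < 1 ∧ ∀ i, (A *ᵥ w) i ≤ c * w i := by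
  -- Gelfand's formula, in the operator norm that is the maximal absolute row sum: some power of `A`
  -- has all row sums below one.
  obtain ⟨m, hm⟩ : ∃ m : ℕ, ∀ i, ((A ^ m) *ᵥ 1) i < 1 := by
    let _ : NormedRing (Matrix ι ι ℂ) := Matrix.linftyOpNormedRing
    let _ : NormedAlgebra ℂ (Matrix ι ι ℂ) := Matrix.linftyOpNormedAlgebra
    have : CompleteSpace (Matrix ι ι ℂ) := FiniteDimensional.complete ℂ _
    have h := spectrum.pow_nnnorm_pow_one_div_tendsto_nhds_spectralRadius
      (A.map (algebraMap ℝ ℂ))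
    obtain ⟨m, hlt, hm0⟩ := ((h.eventually_lt_const hρ).and (eventually_gt_atTop 0)).exists
    refine ⟨m, fun i => ?_⟩
    have hnorm : ‖A.map (algebraMap ℝ ℂ) ^ m‖₊ < 1 := by
      by_contra hcon
      refine absurd hlt (not_lt.2 (ENNReal.one_le_rpow ?_ (by positivity)))
      exact_mod_cast not_lt.1 hcon
    have hpow : A.map (algebraMap ℝ ℂ) ^ m = (A ^ m).map (algebraMap ℝ ℂ) :=
      (map_pow (algebraMap ℝ ℂ).mapMatrix A m).symm
    rw [hpow, Matrix.linfty_opNNNorm_def] at hnorm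
    have hrow := (Finset.le_sup (f := fun i => ∑ j, ‖(A ^ m).map (algebraMap ℝ ℂ) i j‖₊)
      (Finset.mem_univ i)).trans_lt hnorm
    have hrow' : ∑ j, ‖(A ^ m) i j‖ < 1 := by
      have : ((∑ j, ‖(A ^ m).map (algebraMap ℝ ℂ) i j‖₊ : NNReal) : ℝ) < 1 := by
        exact_mod_cast hrow
      simpa using this
    refine lt_of_le_of_lt ?_ hrow'
    simp only [Matrix.mulVec, dotProduct, Pi.one_apply, mul_one]
    exact Finset.sum_le_sum fun j _ => Real.le_norm_self _
  have hmono : ∀ {u v : ι → ℝ}, (∀ i, u i ≤ v i) → ∀ i, (A *ᵥ u) i ≤ (A *ᵥ v) i :=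
    fun huv i => Finset.sum_le_sum fun j _ => mul_le_mul_of_nonneg_left (huv j) (hA i j)
  have hnn : ∀ k i, 0 ≤ ((A ^ k) *ᵥ 1) i := by
    intro k
    induction k with
    | zero => simp
    | succ k ih =>
      intro i
      rw [pow_succ', ← Matrix.mulVec_mulVec]
      exact Finset.sum_nonneg fun j _ => mul_nonneg (hA i j) (ih j)
  rcases isEmpty_or_nonempty ι with hι | hι
  · exact ⟨1, 0, isEmptyElim, le_rfl, one_pos, isEmptyElim⟩
  have hm0 : m ≠ 0 := by
    rintro rfl
    simpa using hm hι.some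
  -- A truncated Neumann series: `A w` telescopes to `w - 1 + A ^ m 1`, which is below `w` in every
  -- coordinate.
  set w : ι → ℝ := fun i => ∑ k ∈ Finset.range m, ((A ^ k) *ᵥ 1) i with hw
  have hAw : ∀ i, (A *ᵥ w) i = w i - 1 + ((A ^ m) *ᵥ 1) i := by
    intro i
    have h1 : w = ∑ k ∈ Finset.range m, (A ^ k) *ᵥ 1 := by
      ext i
      simp [hw]
    have h2 : (A *ᵥ w) i = ∑ k ∈ Finset.range m, ((A ^ (k + 1)) *ᵥ 1) i := by
      rw [h1, Matrix.mulVec_sum, Finset.sum_apply]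
      simp only [Matrix.mulVec_mulVec, pow_succ']
    have h3 := Finset.sum_range_succ (fun k => ((A ^ k) *ᵥ 1) i) m
    rw [Finset.sum_range_succ'] at h3
    simp only [pow_zero, Matrix.one_mulVec, Pi.one_apply] at h3
    rw [h2]
    simp only [hw]
    linarith
  have hw1 : ∀ i, 1 ≤ w i := by
    intro i
    have := Finset.single_le_sum (f := fun k => ((A ^ k) *ᵥ 1) i) (fun k _ => hnn k i)
      (Finset.mem_range.2 (Nat.pos_of_ne_zero hm0))
    simpa using this
  have hlt : ∀ i, (A *ᵥ w) i / w i < 1 := fun i => by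
    rw [div_lt_one (one_pos.trans_le (hw1 i)), hAw]
    linarith [hm i]
  -- The largest of finitely many ratios below one serves as `c`.
  obtain ⟨i₀, hi₀⟩ := Finite.exists_max fun i => (A *ᵥ w) i / w i
  refine ⟨w, (A *ᵥ w) i₀ / w i₀, fun i => one_pos.trans_le (hw1 i), ?_, hlt i₀, fun i => ?_⟩
  · refine div_nonneg (Finset.sum_nonneg fun j _ => mul_nonneg (hA _ j) ?_) ?_
    · exact zero_le_one.trans (hw1 j)
    · exact zero_le_one.trans (hw1 i₀)
  · exact (div_le_iff₀ (one_pos.trans_le (hw1 i))).1 (hi₀ i)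

/-! ### Contraction principle for a weighted maximum distance -/

/-- A map that contracts a weighted maximum distance on a finite product of complete spaces has
a fixed point that attracts all orbits. -/
theorem exists_attracting_fixedPoint_of_weighted_contraction {κ : Type*} [Fintype κ]
    {Y : κ → Type*} [∀ i, MetricSpace (Y i)] [∀ i, CompleteSpace (Y i)] [∀ i, Nonempty (Y i)]
    (f : (∀ i, Y i) → ∀ i, Y i) (w : κ → ℝ) (c : ℝ) (hw : ∀ i, 0 < w i) (hc : 0 ≤ c)
    (hc1 : c < 1)
    (hf : ∀ (x y : ∀ i, Y i) (M : ℝ), 0 ≤ M → (∀ i, dist (x i) (y i) ≤ M * w i) →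
      ∀ i, dist (f x i) (f y i) ≤ c * M * w i) :
    ∃ p, f p = p ∧ ∀ x, Tendsto (fun k : ℕ => dist (f^[k] x) p) atTop (𝓝 0) := by
  -- `W` and `V` bound each `w i` and each `(w i)⁻¹`, so they compare the weighted distance with the
  -- maximum distance. Sums instead of maxima also cover an empty index type.
  set W : ℝ := ∑ i, w i with hW
  set V : ℝ := ∑ i, (w i)⁻¹ with hV
  have hW0 : 0 ≤ W := Finset.sum_nonneg fun i _ => (hw i).le
  have hV0 : 0 ≤ V := Finset.sum_nonneg fun i _ => (inv_pos.2 (hw i)).le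
  have hiter : ∀ (k : ℕ) (x y : ∀ i, Y i) (i : κ),
      dist (f^[k] x i) (f^[k] y i) ≤ c ^ k * (dist x y * V) * w i := by
    intro k x y
    induction k with
    | zero =>
      intro i
      have h1 : 1 ≤ V * w i := by
        have := Finset.single_le_sum (f := fun i => (w i)⁻¹)
          (fun i _ => (inv_pos.2 (hw i)).le) (Finset.mem_univ i)
        rw [← inv_mul_cancel₀ (hw i).ne']
        exact mul_le_mul_of_nonneg_right this (hw i).le
      calc dist (x i) (y i) ≤ dist x y * 1 := by
            rw [mul_one]
            exact dist_le_pi_dist x y i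
        _ ≤ dist x y * (V * w i) := mul_le_mul_of_nonneg_left h1 dist_nonneg
        _ = c ^ 0 * (dist x y * V) * w i := by ring
    | succ k ih =>
      intro i
      rw [Function.iterate_succ_apply', Function.iterate_succ_apply', pow_succ', mul_assoc c]
      exact hf _ _ _ (by positivity) ih i
  have hdist : ∀ (k : ℕ) (x y : ∀ i, Y i),
      dist (f^[k] x) (f^[k] y) ≤ dist x y * V * W * c ^ k := by
    intro k x y
    refine (dist_pi_le_iff (by positivity)).2 fun i => (hiter k x y i).trans ?_
    have := Finset.single_le_sum (fun i _ => (hw i).le) (Finset.mem_univ i)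
    calc c ^ k * (dist x y * V) * w i ≤ c ^ k * (dist x y * V) * W :=
          mul_le_mul_of_nonneg_left this (by positivity)
      _ = dist x y * V * W * c ^ k := by ring
  have hgeom : ∀ a : ℝ, Tendsto (fun k : ℕ => a * c ^ k) atTop (𝓝 0) := fun a => by
    simpa using (tendsto_pow_atTop_nhds_zero_of_lt_one hc hc1).const_mul a
  -- The constant `V * W * c` may exceed one: `f` need not contract the maximum distance itself, but
  -- its iterates satisfy a geometric bound.
  have hcont : Continuous f := by
    refine (LipschitzWith.of_dist_le' (K := V * W * c) fun x y => ?_).continuous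
    refine (hdist 1 x y).trans (le_of_eq ?_)
    ring
  let x₀ : ∀ i, Y i := fun i => Classical.arbitrary (Y i)
  have hcauchy : CauchySeq fun k => f^[k] x₀ :=
    cauchySeq_of_le_geometric c (dist x₀ (f x₀) * V * W) hc1 fun k => by
      rw [Function.iterate_succ_apply]
      exact hdist k x₀ (f x₀)
  obtain ⟨p, hp⟩ := cauchySeq_tendsto_of_complete hcauchy
  have hfix : Function.IsFixedPt f p := isFixedPt_of_tendsto_iterate hp hcont.continuousAt
  refine ⟨p, hfix, fun x => squeeze_zero (fun _ => dist_nonneg) (fun k => ?_)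
    (hgeom (dist x p * V * W))⟩
  calc dist (f^[k] x) p = dist (f^[k] x) (f^[k] p) := by rw [(hfix.iterate k).eq]
    _ ≤ _ := hdist k x p

/-! ### Contraction estimates for components and their substitutions -/

namespace DynamicalNetwork

theorem L_nonneg {ι : Type*} {X : ι → Type*} [∀ i, MetricSpace (X i)]
    (N : DynamicalNetwork X) (i : ι) : 0 ≤ N.L i :=
  Real.sSup_nonneg (by
    rintro r ⟨x, y, -, rfl⟩
    positivity)

theorem IsStabilityMatrix.nonneg {ι : Type*} [Fintype ι] [DecidableEq ι] {X : ι → Type*}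
    [∀ i, MetricSpace (X i)] {N : DynamicalNetwork X} {A : Matrix ι ι ℝ}
    (hA : N.IsStabilityMatrix A) (i j : ι) : 0 ≤ A i j := by
  obtain ⟨Λ, hΛ, rfl⟩ := hA
  rw [Matrix.mul_diagonal, Matrix.transpose_apply]
  exact mul_nonneg (hΛ.1 j i) (N.L_nonneg j)

/-- Row `j` of `A` collects the Lipschitz constants of the interaction times those of the local
maps, so the distance is at most `M * (A w) j`. -/
theorem IsStabilityMatrix.dist_component_le {ι : Type*} [Fintype ι] [DecidableEq ι]
    {X : ι → Type*} [∀ i, MetricSpace (X i)] [∀ i, Nonempty (X i)] {N : DynamicalNetwork X}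
    {A : Matrix ι ι ℝ} (hA : N.IsStabilityMatrix A) {w : ι → ℝ} (hw : ∀ i, 0 ≤ w i) {c : ℝ}
    (hAw : ∀ i, A.mulVec w i ≤ c * w i) (j : ι) (x y : ∀ i : N.I j, X i) {M : ℝ} (hM : 0 ≤ M)
    (hxy : ∀ i, dist (x i) (y i) ≤ M * w i) :
    dist ((N.component j).toFun x) ((N.component j).toFun y) ≤ c * M * w j := by
  have hpos := hA.nonneg
  obtain ⟨Λ, hΛ, rfl⟩ := hA
  -- The Lipschitz condition concerns points of the full product; the arbitrary coordinates outside
  -- `N.I j` enter neither side of it.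
  let ext (z : ∀ i : N.I j, X i) (i : ι) : X i :=
    if h : i ∈ N.I j then N.φ i (z ⟨i, h⟩) else Classical.arbitrary (X i)
  have hext : ∀ z : ∀ i : N.I j, X i,
      (N.component j).toFun z = N.F j (fun i => ext z i) := fun z =>
    congrArg (N.F j) (funext fun i => by simp [ext])
  have hterm : ∀ i ∈ N.I j, Λ i j * dist (ext x i) (ext y i) ≤
      (Λ.transpose * Matrix.diagonal N.L) j i * (M * w i) := by
    intro i hi
    rw [Matrix.mul_diagonal, Matrix.transpose_apply, mul_assoc]
    refine mul_le_mul_of_nonneg_left ?_ (hΛ.1 i j)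
    simp only [ext, hi, dif_pos]
    exact (N.dist_φ_le i _ _).trans (mul_le_mul_of_nonneg_left (hxy ⟨i, hi⟩) (N.L_nonneg i))
  rw [hext, hext]
  calc _ ≤ ∑ i ∈ N.I j, Λ i j * dist (ext x i) (ext y i) := hΛ.2.2 j _ _
    _ ≤ ∑ i ∈ N.I j, (Λ.transpose * Matrix.diagonal N.L) j i * (M * w i) :=
        Finset.sum_le_sum hterm
    _ ≤ ∑ i, (Λ.transpose * Matrix.diagonal N.L) j i * (M * w i) :=
        Finset.sum_le_sum_of_subset_of_nonneg (Finset.subset_univ _) fun i _ _ =>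
          mul_nonneg (hpos j i) (mul_nonneg hM (hw i))
    _ = M * (Λ.transpose * Matrix.diagonal N.L).mulVec w j := by
        rw [Matrix.mulVec, dotProduct, Finset.mul_sum]
        exact Finset.sum_congr rfl fun i _ => by ring
    _ ≤ M * (c * w j) := mul_le_mul_of_nonneg_left (hAw j) hM
    _ = c * M * w j := by ring

/-- Substitution of components that contract a weighted maximum distance does not spoil a
contraction bound. -/
theorem IsStabilityMatrix.dist_iterSubstitute_le {ι : Type*} [Fintype ι] [DecidableEq ι]
    {X : ι → Type*} [∀ i, MetricSpace (X i)] [∀ i, Nonempty (X i)] {N : DynamicalNetwork X}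
    {A : Matrix ι ι ℝ} (hA : N.IsStabilityMatrix A) {w : ι → ℝ} (hw : ∀ i, 0 ≤ w i) {c : ℝ}
    (hc1 : c ≤ 1) (hAw : ∀ i, A.mulVec w i ≤ c * w i) (S : Finset ι) (j : ι) (k : ℕ)
    (x y : ∀ i : (N.iterSubstitute S j k).vars, X i) {M : ℝ} (hM : 0 ≤ M)
    (hxy : ∀ i, dist (x i) (y i) ≤ M * w i) :
    dist ((N.iterSubstitute S j k).toFun x) ((N.iterSubstitute S j k).toFun y) ≤
      c * M * w j := by
  induction k with
  | zero => exact hA.dist_component_le hw hAw j x y hM hxy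
  | succ k ih =>
    -- The same `M` is kept: the factor `c` gained by a substituted variable is discarded, and the
    -- one in the conclusion comes from the outermost component.
    refine ih _ _ fun l => ?_
    by_cases h : (l : ι) ∈ S
    · simp only [h, dif_pos]
      exact hxy _
    · simp only [h, dif_neg, not_false_eq_true]
      refine (hA.dist_component_le hw hAw l _ _ hM fun i => hxy _).trans ?_
      exact mul_le_mul_of_nonneg_right (mul_le_of_le_one_left hM hc1) (hw l)

end DynamicalNetwork

theorem theorem6p2 {ι : Type*} [Fintype ι] [DecidableEq ι] {X : ι → Type*}
    [∀ i, MetricSpace (X i)] [∀ i, CompleteSpace (X i)] [∀ i, Nonempty (X i)]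
    (N : DynamicalNetwork X) (A : Matrix ι ι ℝ) (hA : N.IsStabilityMatrix A)
    (hρ : spectralRadius ℂ (A.map (algebraMap ℝ ℂ)) < 1)
    (S : Finset ι) (hS : N.graph.IsCompleteStructuralSet S) :
    (N.restriction S hS).HasGloballyAttractingFixedPoint := by
  obtain ⟨w, c, hw, hc, hc1, hAw⟩ :=
    A.exists_pos_weight_of_spectralRadius_lt_one hA.nonneg hρ
  refine exists_attracting_fixedPoint_of_weighted_contraction _ (fun i : S => w i) c
    (fun i => hw i) hc hc1 fun x y M hM hxy j => ?_
  -- The number of rounds may vary with `j`; the bound does not depend on it.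
  exact hA.dist_iterSubstitute_le (fun i => (hw i).le) hc1.le hAw S j _ _ _ hM fun i => hxy _
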